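/- Fix an additively optimal universal prefix machine $U$ with side information, and let $K(s\mid y)$ be the length of a shortest program with which $U$, given the string $y$, prints the binary string $s$ and halts. For ${\bf u}\in[0,1]^n$ let $K({\bf u}\mid n,m)$ be the least $K(s\mid n,m)$ over the strings $s$ that are the concatenation of finite binary expansions (of one common length) of $u_1,\dots,u_n$ (and $\infty$ if there is no such $s$). For ${\bf x}\in[0,1]^n$ put $$K^{[\cdot]_m}({\bf x})=\inf\{K({\bf u}\mid n,m):{\bf u}\in[0,1]^n,\ \|{\bf x}-{\bf u}\|_\infty\le 2^{-m}\},\qquad \kappa_{m,n}({\bf x})=\frac{K^{[\cdot]_m}({\bf x})}{m}.$$ **Theorem.** Let $r>1$ and $\sigma>0$. There are $N_0,D_0$ (depending on $U$, $r$, $\sigma$ only) such that the following holds for all $n\ge N_0$ and all ${\bf x}_o\in[0,1]^n$. Let $m=\lceil\log_2 n\rceil$, $\kappa_n=\kappa_{m,n}({\bf x}_o)$ and $d=\lceil 8r\kappa_n m\rceil$, and suppose $d\ge D_0$. Let ${\bf y}_o=A{\bf x}_o+{\bf w}$, where the entries of $A\in\mathbb R^{d\times n}$ are $\mathcal N(0,1)$,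 the entries of ${\bf w}\in\mathbb R^d$ are $\mathcal N(0,\sigma^2)$, and all these variables are independent. Then the low-complexity least-squares problem $$\min\ \|A{\bf x}-{\bf y}_o\|_2\quad\text{subject to}\quad {\bf x}\in[0,1]^n,\ K^{[\cdot]_m}({\bf x})\le\kappa_n m$$ has a solution, and for every choice $\hat{\bf x}_o$ of a solution $$\mathbb P\Big(\|{\bf x}_o-\hat{\bf x}_o\|_2^2>\frac{9\sigma^2}{r}\Big)<6e^{-0.01d}+e^{-0.3m\kappa_n}.$$ -/

import Mathlib

open MeasureTheory ProbabilityTheory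
open scoped NNReal ENNReal

noncomputable section

namespace KolmogorovCS

/-! ### Conditional prefix Kolmogorov complexity -/

/-- A (conditional) prefix machine: a partial recursive map taking a program `s` and a side
information string `y` to an output string, such that for every fixed side information no halting
program is a proper prefix of another halting program. -/
structure IsPrefixMachine (T : List Bool → List Bool →. List Bool) : Prop where
  partrec : Partrec₂ T
  prefixFree : ∀ y s t : List Bool, (T s y).Dom → (T t y).Dom → s <+: t → s = t

/-- `K_T(x | y)`: the length of a shortest program that makes `T`, having access to `y`, print `x`
and halt (`⊤` if there is no such program). -/
def condK (T : List Bool → List Bool →. List Bool) (x y : List Bool) : ℕ∞ :=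
  ⨅ (s : List Bool) (_ : x ∈ T s y), (s.length : ℕ∞)

/-- An additively optimal universal prefix machine. -/
structure IsOptimalMachine (U : List Bool → List Bool →. List Bool) : Prop where
  isPrefixMachine : IsPrefixMachine U
  optimal : ∀ T : List Bool → List Bool →. List Bool, IsPrefixMachine T →
    ∃ c : ℕ, ∀ x y : List Bool, condK U x y ≤ condK T x y + c

/-- The side information "`n, m`" as one binary string: the binary digits of `n`, each written
twice, then the separator `10`, then the binary digits of `m`. -/
def pairCode (n m : ℕ) : List Bool :=
  (n.bits.flatMap fun b => [b, b]) ++ [true, false] ++ m.bits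

/-! ### Complexity of real vectors -/

/-- The number `0.b₁b₂…b_L` in base two. -/
def binaryValue (b : List Bool) : ℝ :=
  ∑ j : Fin b.length, if b.get j then (1 / 2 : ℝ) ^ (j.val + 1) else 0

/-- The string `b` is the concatenation of finite binary expansions, of one common length `L`, of
the coordinates of `u`. -/
def Describes {n : ℕ} (b : List Bool) (u : EuclideanSpace ℝ (Fin n)) : Prop :=
  ∃ (L : ℕ) (B : Fin n → List Bool), (∀ i, (B i).length = L) ∧
    b = (List.ofFn B).flatten ∧ ∀ i, binaryValue (B i) = u i

/-- `K(u | n, m)` for a real vector `u`; it is `⊤` unless every coordinate of `u` has a finite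
binary expansion. -/
def vecK (U : List Bool → List Bool →. List Bool) {n : ℕ} (m : ℕ)
    (u : EuclideanSpace ℝ (Fin n)) : ℕ∞ :=
  ⨅ (b : List Bool) (_ : Describes b u), condK U b (pairCode n m)

/-- The cube `[0,1]ⁿ`. -/
def cube (n : ℕ) : Set (EuclideanSpace ℝ (Fin n)) :=
  {x | ∀ i, x i ∈ Set.Icc (0 : ℝ) 1}

/-- The Kolmogorov complexity of `x` at resolution `m`. -/
def quantK (U : List Bool → List Bool →. List Bool) {n : ℕ} (m : ℕ)
    (x : EuclideanSpace ℝ (Fin n)) : ℕ∞ :=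
  ⨅ (u : EuclideanSpace ℝ (Fin n)) (_ : u ∈ cube n)
    (_ : ∀ i, |x i - u i| ≤ (1 / 2 : ℝ) ^ m), vecK U m u

/-- The Kolmogorov information dimension of `x` at resolution `m`. (For an optimal machine and
`x ∈ [0,1]ⁿ` the complexity is finite, so `toNat` only changes the type.) -/
def kid (U : List Bool → List Bool →. List Bool) {n : ℕ} (m : ℕ)
    (x : EuclideanSpace ℝ (Fin n)) : ℝ :=
  ((quantK U m x).toNat : ℝ) / m

/-! ### Low-complexity least squares -/

/-- The vectors of `[0,1]ⁿ` whose complexity at resolution `m` is (finite and) at most `c`. -/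
def feasible (U : List Bool → List Bool →. List Bool) (n m : ℕ) (c : ℝ) :
    Set (EuclideanSpace ℝ (Fin n)) :=
  {x | x ∈ cube n ∧ ∃ k : ℕ, quantK U m x = k ∧ (k : ℝ) ≤ c}

/-- `x` minimises `‖A z - y‖₂` over all `z ∈ [0,1]ⁿ` of complexity at most `c` at resolution `m`. -/
def IsLLS (U : List Bool → List Bool →. List Bool) {n d : ℕ} (m : ℕ) (c : ℝ)
    (A : Matrix (Fin d) (Fin n) ℝ) (y : EuclideanSpace ℝ (Fin d))
    (x : EuclideanSpace ℝ (Fin n)) : Prop :=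
  x ∈ feasible U n m c ∧
    IsMinOn (fun z : EuclideanSpace ℝ (Fin n) => ‖WithLp.toLp 2 (A.mulVec z.ofLp) - y‖)
      (feasible U n m c) x

end KolmogorovCS

end

/-!
Let `k` be the complexity of `xo` at resolution `m`, so that `κ m = k` and `8 r k ≤ d`. A string
describes at most one vector, hence at most `2 ^ (k + 1)` centres `u` have `K(u | n, m) ≤ k`
(`exists_finset_vecK_le`), and the feasible set is the part of the cube within sup-distance `2⁻ᵐ`
of such centres in the cube. It is compact, so minimisers exist. That `k` is finite, so that `xo` is
feasible, follows by truncating binary expansions (`quantK_ne_top`).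

If `xhat` is a minimiser and `u` a centre close to it, write `e = u - xo` and `q = u - xhat`.
Comparing the residuals of `xhat` and `xo` gives `‖A e - A q - w‖ ≤ ‖w‖`, so that
`2 ⟪A e, w⟫ - ‖A e‖²` is at least `-(4 δ σ + δ²) d` once `‖A q‖ ≤ δ √d` and `‖w‖ ≤ 2 σ √d`
(`neg_le_two_inner_sub_norm_sq`). Three exceptional events have to be controlled.

* The vector `q` is random, but it lies in the cube of radius `2⁻ᵐ ≤ 1 / n`, and a convex function
  on a cube is largest at a vertex. A union bound over the `2 ^ n` vertices, with a chi-square tail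
  for each, bounds `‖A q‖²` by `4 (n + d) / n` (`measureReal_exists_vertex_ge_le`), which is below
  `δ² d` for large `n` and `d`. This takes the place of an operator norm estimate.
* The noise satisfies `‖w‖² ≤ 4 σ² d` by the same tail bound (`measureReal_noise_ge_le`).
* For a fixed centre, `A e` has independent `𝒩(0, ‖e‖²)` entries which are independent of `w`.
  Integrating out `w` and then `A e` in the Chernoff bound with parameter `1 / (4 σ²)` gives the
  factor `(1 + ‖e‖² / (4 σ²)) ^ (-d / 2)` (`measureReal_sum_cross_ge_le`).

An error above `9 σ² / r` forces `‖e‖ ≥ 2 σ / √r`, and then the last factor is at most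
`(1 + 1 / r) ^ (-4 r k) ≤ exp (-8 k / 3)`, which beats the number `2 ^ (k + 1)` of centres
(`union_bound_lt`).
-/

namespace KolmogorovCS

/-! ### Vectors of low complexity and the feasible set -/

theorem vecK_le_iff {U : List Bool → List Bool →. List Bool} {n m k : ℕ}
    {u : EuclideanSpace ℝ (Fin n)} :
    vecK U m u ≤ k ↔
      ∃ b s : List Bool, Describes b u ∧ b ∈ U s (pairCode n m) ∧ s.length ≤ k := by
  rw [← ENat.lt_natCast_add_one_iff]
  simp only [vecK, condK, iInf_lt_iff, ENat.lt_natCast_add_one_iff, Nat.cast_le, exists_prop]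
  grind

theorem quantK_le_iff {U : List Bool → List Bool →. List Bool} {n m k : ℕ}
    {x : EuclideanSpace ℝ (Fin n)} :
    quantK U m x ≤ k ↔ ∃ u ∈ cube n, (∀ i, |x i - u i| ≤ (1 / 2 : ℝ) ^ m) ∧ vecK U m u ≤ k := by
  rw [← ENat.lt_natCast_add_one_iff]
  simp only [quantK, iInf_lt_iff, ENat.lt_natCast_add_one_iff, exists_prop]

/-- The common length of the expansions in a description is the length of the string divided by
the dimension, so a string describes at most one vector. -/
theorem Describes.unique {n : ℕ} {b : List Bool} {u v : EuclideanSpace ℝ (Fin n)}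
    (hu : Describes b u) (hv : Describes b v) : u = v := by
  obtain ⟨L, B, hB, rfl, hBu⟩ := hu
  obtain ⟨L', B', hB', hbb, hBv⟩ := hv
  have hlen : ∀ {M : ℕ} {C : Fin n → List Bool}, (∀ i, (C i).length = M) →
      (List.ofFn C).map List.length = List.replicate n M := by
    intro M C hC
    rw [List.map_ofFn, ← List.ofFn_const]
    exact congrArg List.ofFn (funext hC)
  have hn : n * L = n * L' := by
    have h := congrArg List.length hbb
    simpa [List.length_flatten, hlen hB, hlen hB'] using h
  ext i
  have hL : L = L' := Nat.eq_of_mul_eq_mul_left i.pos hn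
  have hBB : List.ofFn B = List.ofFn B' :=
    List.eq_iff_flatten_eq.2 ⟨hbb, by rw [hlen hB, hlen hB', hL]⟩
  rw [← hBu i, ← hBv i, List.ofFn_injective hBB]

theorem exists_finset_length_le (k : ℕ) :
    ∃ F : Finset (List Bool), (∀ s, s.length ≤ k → s ∈ F) ∧ F.card ≤ 2 ^ (k + 1) := by
  classical
  refine ⟨(Finset.range (k + 1)).biUnion fun l =>
    (Finset.univ : Finset (List.Vector Bool l)).image List.Vector.toList, fun s hs => ?_, ?_⟩
  · simp only [Finset.mem_biUnion, Finset.mem_range, Finset.mem_image, Finset.mem_univ, true_and]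
    exact ⟨s.length, by omega, ⟨s, rfl⟩, rfl⟩
  · calc _ ≤ ∑ l ∈ Finset.range (k + 1), 2 ^ l :=
        Finset.card_biUnion_le.trans (Finset.sum_le_sum fun l _ =>
          Finset.card_image_le.trans (by simp))
      _ ≤ 2 ^ (k + 1) := (Nat.geomSum_lt le_rfl (by simp)).le

/-- A vector of complexity at most `k` is determined by a program of length at most `k`, so there
are at most `2 ^ (k + 1)` such vectors. -/
theorem exists_finset_vecK_le (U : List Bool → List Bool →. List Bool) (n m k : ℕ) :
    ∃ S : Finset (EuclideanSpace ℝ (Fin n)),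
      (∀ u, u ∈ S ↔ vecK U m u ≤ k) ∧ S.card ≤ 2 ^ (k + 1) := by
  classical
  obtain ⟨F, hF, hcard⟩ := exists_finset_length_le k
  let P : List Bool → EuclideanSpace ℝ (Fin n) → Prop := fun s u =>
    s.length ≤ k ∧ ∃ b, Describes b u ∧ b ∈ U s (pairCode n m)
  have hP : ∀ {s u v}, P s u → P s v → u = v := by
    rintro s u v ⟨-, b, hb, hbs⟩ ⟨-, c, hc, hcs⟩
    obtain rfl := Part.mem_unique hbs hcs
    exact hb.unique hc
  let f : List Bool → EuclideanSpace ℝ (Fin n) := fun s => if h : ∃ u, P s u then h.choose else 0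
  have hf : ∀ {s u}, P s u → f s = u := by
    intro s u h
    have hex : ∃ u, P s u := ⟨u, h⟩
    simp only [f, dif_pos hex]
    exact hP hex.choose_spec h
  refine ⟨(F.image f).filter fun u => vecK U m u ≤ k, fun u => ?_,
    (Finset.card_filter_le _ _).trans (Finset.card_image_le.trans hcard)⟩
  simp only [Finset.mem_filter, Finset.mem_image, and_iff_right_iff_imp]
  intro hu
  obtain ⟨b, s, hb, hs, hl⟩ := vecK_le_iff.1 hu
  exact ⟨s, hF s hl, hf ⟨hl, b, hb, hs⟩⟩

theorem mem_feasible_iff {U : List Bool → List Bool →. List Bool} {n m k : ℕ}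
    {x : EuclideanSpace ℝ (Fin n)} :
    x ∈ feasible U n m k ↔
      x ∈ cube n ∧ ∃ u ∈ cube n, (∀ i, |x i - u i| ≤ (1 / 2 : ℝ) ^ m) ∧ vecK U m u ≤ k := by
  rw [feasible, Set.mem_ofPred_eq, ← quantK_le_iff]
  refine and_congr_right fun _ => ⟨?_, fun h => ?_⟩
  · rintro ⟨j, hj, hjk⟩
    rw [hj]
    exact_mod_cast hjk
  · obtain ⟨j, hj⟩ := ENat.ne_top_iff_exists.1 (ne_top_of_le_ne_top (ENat.natCast_ne_top k) h)
    exact ⟨j, hj.symm, by rw [← hj] at h; exact_mod_cast h⟩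

theorem isCompact_cube (n : ℕ) : IsCompact (cube n) := by
  have h : cube n = (EuclideanSpace.equiv (Fin n) ℝ).toHomeomorph ⁻¹'
      Set.univ.pi fun _ => Set.Icc (0 : ℝ) 1 := by
    ext x; simp [cube, Pi.le_def, forall_and]
  rw [h, Homeomorph.isCompact_preimage]
  exact isCompact_univ_pi fun _ => isCompact_Icc

/-- The feasible set is a finite union of closed pieces of the cube, one for each vector of
complexity at most `k`. -/
theorem isCompact_feasible (U : List Bool → List Bool →. List Bool) (n m k : ℕ) :
    IsCompact (feasible U n m k) := by
  obtain ⟨S, hS, -⟩ := exists_finset_vecK_le U n m k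
  refine (isCompact_cube n).of_isClosed_subset ?_ fun x hx => hx.1
  have h : feasible U n m k = cube n ∩ ⋃ u ∈ S, {x | u ∈ cube n ∧
      ∀ i, |x i - u i| ≤ (1 / 2 : ℝ) ^ m} := by
    ext x
    simp only [mem_feasible_iff, Set.mem_inter_iff, Set.mem_iUnion, Set.mem_ofPred_eq, hS,
      exists_prop]
    grind
  rw [h]
  refine (isCompact_cube n).isClosed.inter (S.finite_toSet.isClosed_biUnion fun u _ => ?_)
  simp only [Set.ofPred_and, Set.ofPred_forall]
  exact isClosed_const.inter (isClosed_iInter fun i =>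
    isClosed_le (by fun_prop) continuous_const)

theorem exists_isLLS {U : List Bool → List Bool →. List Bool} {n d m k : ℕ}
    (hne : (feasible U n m k).Nonempty) (A : Matrix (Fin d) (Fin n) ℝ)
    (y : EuclideanSpace ℝ (Fin d)) : ∃ x, IsLLS U m k A y x := by
  have hc : Continuous fun z : EuclideanSpace ℝ (Fin n) =>
      ‖WithLp.toLp 2 (A.mulVec z.ofLp) - y‖ := by
    have : Continuous fun z : EuclideanSpace ℝ (Fin n) => A.mulVec z.ofLp :=
      Continuous.matrix_mulVec continuous_const (by fun_prop)
    fun_prop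
  exact (isCompact_feasible U n m k).exists_isMinOn hne hc.continuousOn

/-! ### Finiteness of the complexity on the cube -/

/-- The prefix machine that prints `b` on the empty program and halts on no other. -/
def constMachine (b : List Bool) : List Bool → List Bool →. List Bool :=
  fun s _ => Part.assert (s = []) fun _ => Part.some b

theorem isPrefixMachine_constMachine (b : List Bool) : IsPrefixMachine (constMachine b) where
  partrec := by
    have h : Primrec fun p : List Bool × List Bool => if p.1 = [] then some b else none :=
      Primrec.ite (Primrec.eq.comp Primrec.fst (Primrec.const [])) (Primrec.const _)
        (Primrec.const none)
    refine (Computable.ofOption h.to_comp).of_eq fun p => ?_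
    rcases p with ⟨_ | ⟨c, s⟩, y⟩ <;> ext <;> simp [constMachine]
  prefixFree := by
    rintro y s t ⟨rfl, -⟩ ⟨rfl, -⟩ -
    rfl

theorem condK_ne_top {U : List Bool → List Bool →. List Bool} (hU : IsOptimalMachine U)
    (b y : List Bool) : condK U b y ≠ ⊤ := by
  obtain ⟨c, hc⟩ := hU.optimal _ (isPrefixMachine_constMachine b)
  have h : condK (constMachine b) b y ≤ 0 :=
    iInf₂_le_of_le [] (by simp [constMachine]) (by simp)
  refine ne_top_of_le_ne_top (ENat.natCast_ne_top c) ((hc b y).trans ?_)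
  simpa using add_le_add_left h (c : ℕ∞)

theorem binaryValue_cons (c : Bool) (b : List Bool) :
    binaryValue (c :: b) = ((if c then 1 else 0) + binaryValue b) / 2 := by
  simp only [binaryValue, List.length_cons, Fin.sum_univ_succ, List.get_eq_getElem]
  rw [add_div, Finset.sum_div]
  congr 1
  · cases c <;> simp
  · refine Finset.sum_congr rfl fun j _ => ?_
    simp only [Fin.val_succ, List.getElem_cons_succ]
    split
    · rw [pow_succ]; ring
    · simp

/-- Truncating binary expansions: every point of `[0,1]` is within `2⁻ᵐ` of a number with `m`
binary digits. -/
theorem exists_binaryValue_near (m : ℕ) {x : ℝ} (hx : x ∈ Set.Icc (0 : ℝ) 1) :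
    ∃ b : List Bool, b.length = m ∧ binaryValue b ∈ Set.Icc (0 : ℝ) 1 ∧
      |x - binaryValue b| ≤ (1 / 2) ^ m := by
  induction m generalizing x with
  | zero => exact ⟨[], rfl, by simp [binaryValue], by
      simpa [binaryValue, abs_le] using ⟨by linarith [hx.1], hx.2⟩⟩
  | succ m ih =>
    obtain ⟨c, hc⟩ : ∃ c : Bool, 2 * x - (if c then 1 else 0) ∈ Set.Icc (0 : ℝ) 1 := by
      rcases le_total x (1 / 2) with h | h
      · exact ⟨false, by simp; constructor <;> linarith [hx.1]⟩
      · exact ⟨true, by simp; constructor <;> linarith [hx.2]⟩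
    obtain ⟨b, hb, hb1, hb2⟩ := ih hc
    refine ⟨c :: b, by simp [hb], ?_, ?_⟩
    · rw [binaryValue_cons]
      cases c <;> simp <;> constructor <;> linarith [hb1.1, hb1.2]
    · rw [binaryValue_cons, pow_succ]
      rw [abs_le] at hb2 ⊢
      constructor <;> linarith [hb2.1, hb2.2]

theorem quantK_ne_top {U : List Bool → List Bool →. List Bool} (hU : IsOptimalMachine U)
    {n : ℕ} (m : ℕ) {x : EuclideanSpace ℝ (Fin n)} (hx : x ∈ cube n) : quantK U m x ≠ ⊤ := by
  choose B hB hB1 hB2 using fun i => exists_binaryValue_near m (hx i)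
  let u : EuclideanSpace ℝ (Fin n) := WithLp.toLp 2 fun i => binaryValue (B i)
  have hu : Describes (List.ofFn B).flatten u := ⟨m, B, hB, rfl, fun _ => rfl⟩
  have h : vecK U m u ≤ condK U (List.ofFn B).flatten (pairCode n m) :=
    iInf₂_le (List.ofFn B).flatten hu
  exact ne_top_of_le_ne_top (condK_ne_top hU _ _) (((iInf₂_le u hB1).trans (iInf_le _ hB2)).trans h)

/-! ### Tail bounds for Gaussian sums -/

/-- `𝔼 exp (-c X²) = (1 + 2 c v)^(-1/2)` for `X ∼ 𝒩(0, v)`. When `1 + 2 c v ≤ 0` the left side is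
not integrable, and both sides are `0` by convention. -/
theorem integral_exp_neg_mul_sq_gaussianReal {v : ℝ≥0} (hv : v ≠ 0) (c : ℝ) :
    ∫ x, Real.exp (-c * x ^ 2) ∂gaussianReal 0 v = (√(1 + 2 * c * v))⁻¹ := by
  have hv' : (0 : ℝ) < v := by positivity
  rw [integral_gaussianReal_eq_integral_smul hv]
  have h : ∀ x : ℝ, gaussianPDFReal 0 v x • Real.exp (-c * x ^ 2) =
      (√(2 * Real.pi * v))⁻¹ * Real.exp (-((1 + 2 * c * v) / (2 * v)) * x ^ 2) := by
    intro x
    rw [gaussianPDFReal_def, smul_eq_mul, mul_assoc, ← Real.exp_add]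
    congr 2
    field_simp
    ring
  simp_rw [h]
  rw [integral_const_mul, integral_gaussian, ← Real.sqrt_inv, ← Real.sqrt_inv,
    ← Real.sqrt_mul (by positivity)]
  congr 1
  field_simp

theorem integrable_exp_neg_mul_sq_gaussianReal {v : ℝ≥0} (hv : v ≠ 0) {c : ℝ}
    (hc : 0 < 1 + 2 * c * v) :
    Integrable (fun x => Real.exp (-c * x ^ 2)) (gaussianReal 0 v) := by
  refine Integrable.of_integral_ne_zero ?_
  rw [integral_exp_neg_mul_sq_gaussianReal hv]
  positivity

variable {Ω : Type*} [MeasurableSpace Ω] {μ : Measure Ω}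

/-- The Chernoff bound for a sum of independent variables with a common moment generating
function at `t`. -/
theorem measureReal_sum_ge_le [IsProbabilityMeasure μ] {d : ℕ} {Y : Fin d → Ω → ℝ}
    (hY : iIndepFun Y μ) (hm : ∀ i, AEMeasurable (Y i) μ) {t c : ℝ} (ht : 0 ≤ t) (hc : 0 < c)
    (hmgf : ∀ i, mgf (Y i) μ t = c) (a : ℝ) :
    μ.real {ω | a ≤ ∑ i, Y i ω} ≤ Real.exp (-t * a) * c ^ d := by
  have h : mgf (∑ i, Y i) μ t = c ^ d := by
    rw [hY.mgf_sum₀ hm]; simp [hmgf]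
  have hint : Integrable (fun ω => Real.exp (t * (∑ i, Y i) ω)) μ :=
    mgf_pos_iff.1 (h ▸ pow_pos hc d)
  have := measure_ge_le_exp_mul_mgf a ht hint
  simpa [h] using this

theorem mgf_sq_of_hasLaw {X : Ω → ℝ} {v : ℝ≥0} (hX : HasLaw X (gaussianReal 0 v) μ)
    (hv : v ≠ 0) : mgf (fun ω => X ω ^ 2) μ (1 / (4 * v)) = √2 := by
  have hv' : (0 : ℝ) < v := by positivity
  have hcv : 1 + 2 * (-(1 / (4 * (v : ℝ)))) * v = 1 / 2 := by field_simp; norm_num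
  have h := hX.integral_comp (f := fun x => Real.exp (1 / (4 * v) * x ^ 2))
    (by fun_prop : Measurable _).aestronglyMeasurable
  have h' := integral_exp_neg_mul_sq_gaussianReal hv (-(1 / (4 * (v : ℝ))))
  rw [hcv, neg_neg] at h'
  rw [mgf]
  refine (h.trans h').trans ?_
  rw [← Real.sqrt_inv]
  norm_num

theorem measureReal_sum_sq_ge_le [IsProbabilityMeasure μ] {d : ℕ} {X : Fin d → Ω → ℝ} {v : ℝ≥0}
    (hX : ∀ i, HasLaw (X i) (gaussianReal 0 v) μ) (hind : iIndepFun X μ) (hv : v ≠ 0) (a : ℝ) :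
    μ.real {ω | a ≤ ∑ i, X i ω ^ 2} ≤ Real.exp (-(1 / (4 * v)) * a) * √2 ^ d :=
  measureReal_sum_ge_le (Y := fun i ω => X i ω ^ 2)
    (hind.comp (fun _ x => x ^ 2) fun _ => by fun_prop)
    (fun i => (hX i).aemeasurable.pow_const 2) (by positivity) (by positivity)
    (fun i => mgf_sq_of_hasLaw (hX i) hv) a

/-- For independent `X ∼ 𝒩(0, v)` and `W ∼ 𝒩(0, s)`, integrating first over `W` turns
`exp ((2XW - X²) / (4s))` into `exp (-X² / (8s))`. -/
theorem mgf_two_mul_sub_sq [IsProbabilityMeasure μ] {X W : Ω → ℝ} {v s : ℝ≥0}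
    (hX : HasLaw X (gaussianReal 0 v) μ) (hW : HasLaw W (gaussianReal 0 s) μ)
    (hind : IndepFun X W μ) (hv : v ≠ 0) (hs : s ≠ 0) :
    mgf (fun ω => 2 * X ω * W ω - X ω ^ 2) μ (1 / (4 * s)) = (√(1 + v / (4 * s)))⁻¹ := by
  have hs' : (0 : ℝ) < s := by positivity
  have hlaw : HasLaw (fun ω => (X ω, W ω)) ((gaussianReal 0 v).prod (gaussianReal 0 s)) μ :=
    ⟨hX.aemeasurable.prodMk hW.aemeasurable, by
      rw [(indepFun_iff_map_prod_eq_prod_map_map hX.aemeasurable hW.aemeasurable).1 hind,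
        hX.map_eq, hW.map_eq]⟩
  let f : ℝ × ℝ → ℝ := fun p => Real.exp (1 / (4 * s) * (2 * p.1 * p.2 - p.1 ^ 2))
  have hf : Measurable f := by fun_prop
  have hfx : ∀ x y : ℝ, f (x, y) =
      Real.exp (-(1 / (4 * s)) * x ^ 2) * Real.exp ((x / (2 * s)) * y) := by
    intro x y
    rw [← Real.exp_add]
    simp only [f]
    congr 1
    field_simp
    ring
  have hinner : ∀ x : ℝ, ∫ y, f (x, y) ∂gaussianReal 0 s = Real.exp (-(1 / (8 * s)) * x ^ 2) := by
    intro x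
    simp_rw [hfx]
    rw [integral_const_mul]
    have h := congrFun (mgf_id_gaussianReal (μ := 0) (v := s)) (x / (2 * s))
    simp only [mgf, id_eq] at h
    rw [h, ← Real.exp_add]
    congr 1
    field_simp
    ring
  have hcv : 1 + 2 * (1 / (8 * (s : ℝ))) * v = 1 + v / (4 * s) := by field_simp; ring
  have hpos : 0 < 1 + 2 * (1 / (8 * (s : ℝ))) * v := by positivity
  have hint : Integrable f ((gaussianReal 0 v).prod (gaussianReal 0 s)) := by
    rw [integrable_prod_iff hf.aestronglyMeasurable]
    refine ⟨.of_forall fun x => ?_, ?_⟩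
    · simp_rw [hfx]
      exact (integrable_exp_mul_gaussianReal _).const_mul _
    · have h : ∀ x y, ‖f (x, y)‖ = f (x, y) := fun x y => Real.norm_of_nonneg (Real.exp_nonneg _)
      simp_rw [h, hinner]
      exact integrable_exp_neg_mul_sq_gaussianReal hv hpos
  have h := hlaw.integral_comp (f := f) hf.aestronglyMeasurable
  rw [integral_prod _ hint] at h
  simp_rw [hinner] at h
  rw [integral_exp_neg_mul_sq_gaussianReal hv, hcv] at h
  exact h

/-- The sum `∑ (2XW - X²)` is `‖W‖² - ‖X - W‖²`: subtracting `X` from the noise `W` rarely brings it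
much closer to `0`. -/
theorem measureReal_sum_cross_ge_le [IsProbabilityMeasure μ] {d : ℕ} {X W : Fin d → Ω → ℝ}
    {v s : ℝ≥0} (hX : ∀ i, HasLaw (X i) (gaussianReal 0 v) μ)
    (hW : ∀ i, HasLaw (W i) (gaussianReal 0 s) μ)
    (hind : iIndepFun (fun i ω => (X i ω, W i ω)) μ) (hXW : ∀ i, IndepFun (X i) (W i) μ)
    (hv : v ≠ 0) (hs : s ≠ 0) (a : ℝ) :
    μ.real {ω | a ≤ ∑ i, (2 * X i ω * W i ω - X i ω ^ 2)} ≤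
      Real.exp (-(1 / (4 * s)) * a) * (√(1 + v / (4 * s)))⁻¹ ^ d :=
  measureReal_sum_ge_le (Y := fun i ω => 2 * X i ω * W i ω - X i ω ^ 2)
    (hind.comp (fun _ p => 2 * p.1 * p.2 - p.1 ^ 2) fun _ => by fun_prop)
    (fun i => (((hX i).aemeasurable.const_mul 2).mul (hW i).aemeasurable).sub
      ((hX i).aemeasurable.pow_const 2)) (by positivity) (by positivity)
    (fun i => mgf_two_mul_sub_sq (hX i) (hW i) (hXW i) hv hs) a

/-! ### Gaussian matrices -/

/-- The rows of an array of independent variables are independent as random vectors. This is the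
converse direction of `ProbabilityTheory.iIndepFun_uncurry'`. -/
theorem iIndepFun_rows {ι κ β : Type*} [Countable ι] [Countable κ] [MeasurableSpace β]
    {Z : ι × κ → Ω → β} (hm : ∀ p, AEMeasurable (Z p) μ) (hZ : iIndepFun Z μ) :
    iIndepFun (fun i ω k => Z (i, k) ω) μ := by
  have := hZ.isProbabilityMeasure
  have hprob : ∀ i k, IsProbabilityMeasure (μ.map (Z (i, k))) := fun i k =>
    Measure.isProbabilityMeasure_map (hm _)
  have hrow : ∀ i, AEMeasurable (fun ω k => Z (i, k) ω) μ := fun i =>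
    aemeasurable_pi_iff.2 fun k => hm (i, k)
  rw [iIndepFun_iff_map_fun_eq_infinitePi_map₀' hrow]
  have hall : AEMeasurable (fun ω p => Z p ω) μ := aemeasurable_pi_iff.2 hm
  have h := congrArg (Measure.map (MeasurableEquiv.curry ι κ β)) (hZ.map_fun_eq_infinitePi_map₀' hm)
  rw [Measure.infinitePi_map_curry (fun i k => μ.map (Z (i, k))),
    AEMeasurable.map_map_of_aemeasurable (by fun_prop) hall] at h
  refine Eq.trans (congrArg (fun g => μ.map g) ?_) (h.trans ?_)
  · rfl
  · congr 1
    funext i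
    have hi : iIndepFun (fun k => Z (i, k)) μ := hZ.precomp (Prod.mk_right_injective i)
    exact (hi.map_fun_eq_infinitePi_map₀' fun k => hm (i, k)).symm

theorem hasLaw_sum_gaussianReal {ι : Type*} [Fintype ι] {X : ι → Ω → ℝ} {v : ι → ℝ≥0}
    (hX : ∀ j, HasLaw (X j) (gaussianReal 0 (v j)) μ) (hind : iIndepFun X μ) :
    HasLaw (fun ω => ∑ j, X j ω) (gaussianReal 0 (∑ j, v j)) μ := by
  have := hind.isProbabilityMeasure
  have hm : AEMeasurable (fun ω => ∑ j, X j ω) μ :=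
    Finset.aemeasurable_fun_sum _ fun j _ => (hX j).aemeasurable
  refine ⟨hm, ?_⟩
  have := Measure.isProbabilityMeasure_map hm
  refine Measure.ext_of_charFun ?_
  rw [hind.charFun_map_fun_sum_eq_prod fun j => (hX j).aemeasurable]
  ext t
  simp [(hX _).map_eq, charFun_gaussianReal, ← Complex.exp_sum, Finset.sum_mul, Finset.sum_div]

theorem two_le_exp_one : (2 : ℝ) ≤ Real.exp 1 := by
  have := Real.add_one_le_exp 1
  linarith

theorem sqrt_two_le_exp_half : √2 ≤ Real.exp (1 / 2) := by
  rw [Real.sqrt_le_left (by positivity), ← Real.exp_nat_mul]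
  norm_num
  exact two_le_exp_one

section GaussianMatrix

variable {n d : ℕ} {A : Fin d → Fin n → Ω → ℝ} {w : Fin d → Ω → ℝ}

/-- Each entry of `A e` is a centred Gaussian variable of variance `‖e‖²`. -/
theorem hasLaw_mulVec (hA : ∀ i j, HasLaw (A i j) (gaussianReal 0 1) μ)
    (hind : iIndepFun (Sum.elim (fun p : Fin d × Fin n => A p.1 p.2) w) μ) (e : Fin n → ℝ)
    (i : Fin d) :
    HasLaw (fun ω => ∑ j, A i j ω * e j) (gaussianReal 0 (∑ j, ‖e j‖₊ ^ 2)) μ := by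
  refine hasLaw_sum_gaussianReal (X := fun j ω => A i j ω * e j) (fun j => ?_) ?_
  · have h := gaussianReal_mul_const (hA i j) (e j)
    convert h using 2
    · simp
    · ext; simp
  · have hinj : Function.Injective fun j : Fin n => (Sum.inl (i, j) : (Fin d × Fin n) ⊕ Fin d) :=
      fun a b h => by simpa using h
    exact (hind.precomp hinj).comp (fun j x => x * e j) fun j => by fun_prop

/-- The noise is treated as an additional column of the matrix, with index `none`, so that the pairs
are functions of independent rows. -/
theorem iIndepFun_mulVec_prodMk (hA : ∀ i j, AEMeasurable (A i j) μ)
    (hw : ∀ i, AEMeasurable (w i) μ)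
    (hind : iIndepFun (Sum.elim (fun p : Fin d × Fin n => A p.1 p.2) w) μ) (e : Fin n → ℝ) :
    iIndepFun (fun i ω => (∑ j, A i j ω * e j, w i ω)) μ := by
  let g : Fin d × Option (Fin n) → (Fin d × Fin n) ⊕ Fin d := fun p =>
    p.2.elim (Sum.inr p.1) fun j => Sum.inl (p.1, j)
  have hg : Function.Injective g := by
    rintro ⟨i, _ | j⟩ ⟨i', _ | j'⟩ h <;> simp_all [g]
  have hm : ∀ p, AEMeasurable (Sum.elim (fun p : Fin d × Fin n => A p.1 p.2) w (g p)) μ := by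
    rintro ⟨i, _ | j⟩
    exacts [hw i, hA i j]
  exact (iIndepFun_rows hm (hind.precomp hg)).comp
    (fun _ z => (∑ j, z (some j) * e j, z none)) fun _ => by fun_prop

theorem indepFun_mulVec (hA : ∀ i j, AEMeasurable (A i j) μ) (hw : ∀ i, AEMeasurable (w i) μ)
    (hind : iIndepFun (Sum.elim (fun p : Fin d × Fin n => A p.1 p.2) w) μ) (e : Fin n → ℝ)
    (i : Fin d) : IndepFun (fun ω => ∑ j, A i j ω * e j) (w i) μ := by
  let c : (Fin d × Fin n) ⊕ Fin d → ℝ := Sum.elim (fun p => e p.2) fun _ => 1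
  let s : Finset ((Fin d × Fin n) ⊕ Fin d) :=
    Finset.univ.map ⟨fun j : Fin n => Sum.inl (i, j), fun a b h => by simpa using h⟩
  have hm : ∀ p, AEMeasurable (Sum.elim (fun p : Fin d × Fin n => A p.1 p.2) w p) μ := by
    rintro (⟨i, j⟩ | i)
    exacts [hA i j, hw i]
  have h := (hind.comp (fun p x => x * c p) fun p => by fun_prop).indepFun_finsetSum_of_notMem₀
    (fun p => (hm p).mul_const (c p)) (s := s) (i := Sum.inr i) (by simp [s])
  convert h using 1
  · ext ω
    simp only [s, c, Finset.sum_map, Finset.sum_apply, Function.comp_apply]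
    rfl
  · ext ω
    simp [c]

/-- With high probability, `‖A q‖²` is at most `4 n (n + d) ρ²` on the whole cube `‖q‖_∞ ≤ ρ`. -/
theorem measureReal_exists_vertex_ge_le [IsProbabilityMeasure μ]
    (hA : ∀ i j, HasLaw (A i j) (gaussianReal 0 1) μ)
    (hind : iIndepFun (Sum.elim (fun p : Fin d × Fin n => A p.1 p.2) w) μ) {ρ : ℝ} (hρ : 0 < ρ)
    (hn : 0 < n) :
    μ.real {ω | ∃ s : Fin n → Bool, 4 * (n * ρ ^ 2) * (n + d) ≤
      ∑ i, (∑ j, A i j ω * if s j then ρ else -ρ) ^ 2} ≤ Real.exp (-(d / 2)) := by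
  have hv : ∀ s : Fin n → Bool,
      (((∑ j, ‖if s j then ρ else -ρ‖₊ ^ 2 : ℝ≥0)) : ℝ) = n * ρ ^ 2 := by
    intro s
    simp
  have hpos : (0 : ℝ) < n * ρ ^ 2 := by positivity
  rw [Set.ofPred_exists]
  have hrows : ∀ e : Fin n → ℝ, iIndepFun (fun i ω => ∑ j, A i j ω * e j) μ := by
    intro e
    have hm : ∀ p : Fin d × Fin n, AEMeasurable (A p.1 p.2) μ := fun p => (hA p.1 p.2).aemeasurable
    exact (iIndepFun_rows (Z := fun p : Fin d × Fin n => A p.1 p.2) hm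
      (hind.precomp Sum.inl_injective)).comp (fun _ z => ∑ j, z j * e j) fun _ => by fun_prop
  have h2 := two_le_exp_one
  have hsqrt := sqrt_two_le_exp_half
  calc μ.real (⋃ s : Fin n → Bool, {ω | 4 * (n * ρ ^ 2) * (n + d) ≤
        ∑ i, (∑ j, A i j ω * if s j then ρ else -ρ) ^ 2})
      ≤ ∑ s : Fin n → Bool, μ.real {ω | 4 * (n * ρ ^ 2) * (n + d) ≤
        ∑ i, (∑ j, A i j ω * if s j then ρ else -ρ) ^ 2} := measureReal_iUnion_fintype_le _
    -- The summand `n` in the threshold produces the factor `exp (-n)` that absorbs the number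
    -- `2 ^ n` of vertices.
    _ ≤ ∑ _s : Fin n → Bool, Real.exp (-(n + d)) * √2 ^ d := by
        refine Finset.sum_le_sum fun s _ => ?_
        have hne : (∑ j, ‖if s j then ρ else -ρ‖₊ ^ 2 : ℝ≥0) ≠ 0 := by
          rw [← NNReal.coe_ne_zero, hv]; exact hpos.ne'
        refine (measureReal_sum_sq_ge_le (hasLaw_mulVec hA hind _) (hrows _) hne _).trans_eq ?_
        rw [hv]
        congr 2
        field_simp
    _ = 2 ^ n * (Real.exp (-(n + d)) * √2 ^ d) := by simp
    _ ≤ Real.exp 1 ^ n * (Real.exp (-(n + d)) * Real.exp (1 / 2) ^ d) := by gcongr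
    _ = Real.exp (-(d / 2)) := by
        rw [← Real.exp_nat_mul, ← Real.exp_nat_mul, ← Real.exp_add, ← Real.exp_add]
        congr 1
        ring

theorem measureReal_noise_ge_le [IsProbabilityMeasure μ] {s : ℝ≥0} (hs : s ≠ 0)
    (hw : ∀ i, HasLaw (w i) (gaussianReal 0 s) μ) (hind : iIndepFun w μ) :
    μ.real {ω | 4 * s * d ≤ ∑ i, w i ω ^ 2} ≤ Real.exp (-(d / 2)) := by
  have hsqrt := sqrt_two_le_exp_half
  have hs' : (0 : ℝ) < s := by positivity
  calc _ ≤ Real.exp (-(1 / (4 * s)) * (4 * s * d)) * √2 ^ d :=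
        measureReal_sum_sq_ge_le hw hind hs _
    _ ≤ Real.exp (-(1 / (4 * s)) * (4 * s * d)) * Real.exp (1 / 2) ^ d := by gcongr
    _ = Real.exp (-(d / 2)) := by
        rw [← Real.exp_nat_mul, ← Real.exp_add]
        congr 1
        field_simp
        ring

end GaussianMatrix

/-! ### The error of a least-squares solution -/

/-- A convex function on the cube `[-ρ, ρ]ⁿ` is largest at a vertex. -/
theorem exists_vertex_norm_mulVec_ge {n d : ℕ} (A : Matrix (Fin d) (Fin n) ℝ) {ρ : ℝ}
    {q : Fin n → ℝ} (hq : ∀ j, |q j| ≤ ρ) :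
    ∃ s : Fin n → Bool, ‖WithLp.toLp 2 (A.mulVec q)‖ ≤
      ‖WithLp.toLp 2 (A.mulVec fun j => if s j then ρ else -ρ)‖ := by
  have hconv : ConvexOn ℝ Set.univ fun z : Fin n → ℝ => ‖WithLp.toLp 2 (A.mulVec z)‖ :=
    (convexOn_univ_norm (E := EuclideanSpace ℝ (Fin d))).comp_linearMap
      ((WithLp.linearEquiv 2 ℝ (Fin d → ℝ)).symm.toLinearMap ∘ₗ A.mulVecLin)
  have hmem : q ∈ convexHull ℝ (Set.univ.pi fun _ : Fin n => ({-ρ, ρ} : Set ℝ)) := by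
    rw [convexHull_pi]
    intro j _
    have h := abs_le.1 (hq j)
    rw [convexHull_pair, segment_eq_Icc (h.1.trans h.2)]
    exact h
  obtain ⟨v, hv, hle⟩ := hconv.exists_ge_of_mem_convexHull (Set.subset_univ _) hmem
  refine ⟨fun j => decide (v j = ρ), hle.trans_eq ?_⟩
  congr 3
  funext j
  have := hv j trivial
  simp only [Set.mem_insert_iff, Set.mem_singleton_iff] at this
  grind

/-- Expanding `‖(a - q) - w‖² ≤ ‖w‖²` when `q` and `w` are bounded. -/
theorem neg_le_two_inner_sub_norm_sq {E : Type*} [NormedAddCommGroup E] [InnerProductSpace ℝ E]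
    {a q w : E} {α β : ℝ} (h : ‖a - q - w‖ ≤ ‖w‖) (hq : ‖q‖ ≤ α) (hw : ‖w‖ ≤ β) :
    -(2 * α * β + α ^ 2) ≤ 2 * inner ℝ a w - ‖a‖ ^ 2 := by
  have h1 : ‖a - w‖ ≤ ‖w‖ + ‖q‖ := by
    calc ‖a - w‖ = ‖(a - q - w) + q‖ := by congr 1; abel
      _ ≤ ‖w‖ + ‖q‖ := (norm_add_le _ _).trans (by gcongr)
  have h2 := norm_sub_sq_real a w
  nlinarith [norm_nonneg (a - w), norm_nonneg w, norm_nonneg q,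
    mul_le_mul hq hw (norm_nonneg w) ((norm_nonneg q).trans hq)]

section ErrorBound

variable [IsProbabilityMeasure μ] {n d : ℕ} {A : Fin d → Fin n → Ω → ℝ} {w : Fin d → Ω → ℝ}

/-- A fixed centre `u` at distance at least `2 σ / √r` from `xo` nearly fits the measurements as
well as `xo` does only with exponentially small probability. -/
theorem measureReal_far_centre_le {r σ η : ℝ} {s : ℝ≥0} (hs : (s : ℝ) = σ ^ 2)
    (hr : 0 < r) (hσ : 0 < σ)
    (hA : ∀ i j, HasLaw (A i j) (gaussianReal 0 1) μ)
    (hw : ∀ i, HasLaw (w i) (gaussianReal 0 s) μ)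
    (hind : iIndepFun (Sum.elim (fun p : Fin d × Fin n => A p.1 p.2) w) μ)
    {e : EuclideanSpace ℝ (Fin n)} (he : 4 * (σ ^ 2 / r) ≤ ‖e‖ ^ 2) :
    μ.real {ω | -(η * d) ≤ ∑ i, (2 * (∑ j, A i j ω * e j) * w i ω - (∑ j, A i j ω * e j) ^ 2)} ≤
      Real.exp (η / (4 * σ ^ 2) * d) * (√(1 + 1 / r))⁻¹ ^ d := by
  have hv : ((∑ j, ‖e j‖₊ ^ 2 : ℝ≥0) : ℝ) = ‖e‖ ^ 2 := by
    rw [EuclideanSpace.norm_sq_eq]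
    push_cast
    simp
  have hpos : 0 < ‖e‖ ^ 2 := lt_of_lt_of_le (by positivity) he
  have hs0 : s ≠ 0 := by
    rw [← NNReal.coe_ne_zero, hs]; positivity
  have hAm : ∀ i j, AEMeasurable (A i j) μ := fun i j => (hA i j).aemeasurable
  have hwm : ∀ i, AEMeasurable (w i) μ := fun i => (hw i).aemeasurable
  refine (measureReal_sum_cross_ge_le (hasLaw_mulVec hA hind e) hw
    (iIndepFun_mulVec_prodMk hAm hwm hind e) (indepFun_mulVec hAm hwm hind e)
    (by rw [← NNReal.coe_ne_zero, hv]; exact hpos.ne') hs0 _).trans ?_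
  rw [hv, hs]
  have h1 : 1 / r ≤ ‖e‖ ^ 2 / (4 * σ ^ 2) := by
    rw [le_div_iff₀ (by positivity)]
    calc 1 / r * (4 * σ ^ 2) = 4 * (σ ^ 2 / r) := by ring
      _ ≤ _ := he
  have h2 : -(1 / (4 * σ ^ 2)) * -(η * d) = η / (4 * σ ^ 2) * d := by ring
  rw [h2]
  gcongr

/-- Off the three exceptional events (some vertex of a small cube has a large image, the noise is
large, a far centre nearly fits the measurements) every solution is close to `xo`. -/
theorem measureReal_error_le {U : List Bool → List Bool →. List Bool} {m k : ℕ} {r σ δ : ℝ}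
    {s : ℝ≥0} (hs : (s : ℝ) = σ ^ 2) (hr : 0 < r) (hσ : 0 < σ) (hδ : 0 < δ) (hn : 0 < n)
    (hcube : 4 * (n * ((1 / 2 : ℝ) ^ m) ^ 2) * (n + d) ≤ δ ^ 2 * d)
    (hres : n * ((1 / 2 : ℝ) ^ m) ^ 2 ≤ σ ^ 2 / r)
    {xo : EuclideanSpace ℝ (Fin n)} (hxo : xo ∈ feasible U n m k)
    (hA : ∀ i j, HasLaw (A i j) (gaussianReal 0 1) μ)
    (hw : ∀ i, HasLaw (w i) (gaussianReal 0 s) μ)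
    (hind : iIndepFun (Sum.elim (fun p : Fin d × Fin n => A p.1 p.2) w) μ)
    {xhat : Ω → EuclideanSpace ℝ (Fin n)}
    (hxhat : ∀ᵐ ω ∂μ, IsLLS U m k (Matrix.of fun i j => A i j ω)
      (WithLp.toLp 2 ((Matrix.of fun i j => A i j ω).mulVec xo.ofLp + fun i => w i ω)) (xhat ω)) :
    μ.real {ω | 9 * σ ^ 2 / r < ‖xo - xhat ω‖ ^ 2} ≤
      2 * Real.exp (-(d / 2)) +
        2 ^ (k + 1) * (Real.exp ((4 * δ * σ + δ ^ 2) / (4 * σ ^ 2) * d) *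
          (√(1 + 1 / r))⁻¹ ^ d) := by
  classical
  obtain ⟨S, hS, hcard⟩ := exists_finset_vecK_le U n m k
  set ρ : ℝ := (1 / 2) ^ m with hρ
  have hρ0 : 0 < ρ := by positivity
  set T := S.filter fun u => 4 * (σ ^ 2 / r) ≤ ‖u - xo‖ ^ 2 with hT
  set E₁ : Set Ω := {ω | ∃ s : Fin n → Bool, 4 * (n * ρ ^ 2) * (n + d) ≤
    ∑ i, (∑ j, A i j ω * if s j then ρ else -ρ) ^ 2} with hE₁
  set E₂ : Set Ω := {ω | 4 * (s : ℝ) * d ≤ ∑ i, w i ω ^ 2} with hE₂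
  set E₃ : EuclideanSpace ℝ (Fin n) → Set Ω := fun u =>
    {ω | -((4 * δ * σ + δ ^ 2) * d) ≤ ∑ i, (2 * (∑ j, A i j ω * (u - xo) j) * w i ω -
      (∑ j, A i j ω * (u - xo) j) ^ 2)} with hE₃
  have hs0 : s ≠ 0 := by
    rw [← NNReal.coe_ne_zero, hs]; positivity
  have hsub : ∀ᵐ ω ∂μ, ω ∈ {ω | 9 * σ ^ 2 / r < ‖xo - xhat ω‖ ^ 2} →
      ω ∈ E₁ ∪ E₂ ∪ ⋃ u ∈ T, E₃ u := by
    filter_upwards [hxhat] with ω hω hbad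
    by_contra hout
    simp only [Set.mem_union, not_or] at hout
    obtain ⟨⟨h₁, h₂⟩, h₃⟩ := hout
    obtain ⟨hfeas, hmin⟩ := hω
    obtain ⟨-, u, -, hclose, hu⟩ := mem_feasible_iff.1 hfeas
    set M : Matrix (Fin d) (Fin n) ℝ := Matrix.of fun i j => A i j ω with hM
    -- The residual of `xo` is the noise itself.
    have hfit : ‖WithLp.toLp 2 (M.mulVec (xhat ω - xo).ofLp) - WithLp.toLp 2 (fun i => w i ω)‖ ≤
        ‖WithLp.toLp 2 (fun i => w i ω)‖ := by
      have h := isMinOn_iff.1 hmin xo hxo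
      have e1 : WithLp.toLp 2 (M.mulVec (xhat ω).ofLp) -
          WithLp.toLp 2 (M.mulVec xo.ofLp + fun i => w i ω) =
          WithLp.toLp 2 (M.mulVec (xhat ω - xo).ofLp) - WithLp.toLp 2 (fun i => w i ω) := by
        rw [WithLp.ofLp_sub, Matrix.mulVec_sub, WithLp.toLp_add, WithLp.toLp_sub]
        abel
      have e2 : WithLp.toLp 2 (M.mulVec xo.ofLp) -
          WithLp.toLp 2 (M.mulVec xo.ofLp + fun i => w i ω) =
          -WithLp.toLp 2 (fun i => w i ω) := by
        rw [WithLp.toLp_add]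
        abel
      rwa [e1, e2, norm_neg] at h
    have hquant : ‖WithLp.toLp 2 (M.mulVec (u - xhat ω).ofLp)‖ ≤ δ * √d := by
      obtain ⟨v, hv⟩ := exists_vertex_norm_mulVec_ge M (q := (u - xhat ω).ofLp) (ρ := ρ)
        fun j => by
          have := hclose j
          rw [abs_sub_comm] at this
          exact this
      refine hv.trans (abs_le_of_sq_le_sq' ?_ (by positivity)).2
      simp only [hE₁, Set.mem_ofPred_eq, not_exists, not_le] at h₁
      rw [EuclideanSpace.real_norm_sq_eq, mul_pow, Real.sq_sqrt (Nat.cast_nonneg d)]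
      exact (h₁ v).le.trans hcube
    have hnoise : ‖WithLp.toLp 2 (fun i => w i ω)‖ ≤ 2 * σ * √d := by
      refine (abs_le_of_sq_le_sq' ?_ (by positivity)).2
      simp only [hE₂, Set.mem_ofPred_eq, not_le, hs] at h₂
      rw [EuclideanSpace.real_norm_sq_eq, mul_pow, mul_pow, Real.sq_sqrt (Nat.cast_nonneg d)]
      norm_num
      exact h₂.le
    have hsplit : WithLp.toLp 2 (M.mulVec (u - xo).ofLp) -
        WithLp.toLp 2 (M.mulVec (u - xhat ω).ofLp) =
        WithLp.toLp 2 (M.mulVec (xhat ω - xo).ofLp) := by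
      rw [← WithLp.toLp_sub, ← Matrix.mulVec_sub, ← WithLp.ofLp_sub, sub_sub_sub_cancel_left]
    have hcross := neg_le_two_inner_sub_norm_sq (a := WithLp.toLp 2 (M.mulVec (u - xo).ofLp))
      (q := WithLp.toLp 2 (M.mulVec (u - xhat ω).ofLp)) (w := WithLp.toLp 2 (fun i => w i ω))
      (by rwa [hsplit]) hquant hnoise
    have huT : u ∈ T := by
      refine Finset.mem_filter.2 ⟨(hS u).2 hu, ?_⟩
      have hq : ‖u - xhat ω‖ ^ 2 ≤ σ ^ 2 / r := by
        rw [EuclideanSpace.real_norm_sq_eq]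
        calc ∑ j, (u - xhat ω) j ^ 2 ≤ ∑ _j : Fin n, ρ ^ 2 := by
              refine Finset.sum_le_sum fun j _ => sq_le_sq' ?_ ?_ <;>
                have := abs_le.1 (hclose j) <;> simp <;> linarith
          _ ≤ _ := by simpa using hres
      have ht : (σ / √r) ^ 2 = σ ^ 2 / r := by rw [div_pow, Real.sq_sqrt hr.le]
      have hbad' : 9 * σ ^ 2 / r < ‖xo - xhat ω‖ ^ 2 := hbad
      have ht0 : 0 < σ / √r := by positivity
      rw [← ht] at hq ⊢
      rw [mul_div_assoc, ← ht] at hbad'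
      have h1 : ‖u - xhat ω‖ ≤ σ / √r := (abs_le_of_sq_le_sq' hq ht0.le).2
      have h2 : 3 * (σ / √r) < ‖xo - xhat ω‖ :=
        lt_of_pow_lt_pow_left₀ 2 (norm_nonneg _) (by rw [mul_pow]; norm_num; exact hbad')
      have h3 : ‖xo - xhat ω‖ ≤ ‖u - xo‖ + ‖u - xhat ω‖ := by
        rw [norm_sub_rev u xo]; exact norm_sub_le_norm_sub_add_norm_sub _ _ _
      have h4 : 2 * (σ / √r) ≤ ‖u - xo‖ := by linarith
      calc 4 * (σ / √r) ^ 2 = (2 * (σ / √r)) ^ 2 := by ring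
        _ ≤ ‖u - xo‖ ^ 2 := by gcongr
    refine h₃ (Set.mem_biUnion huT ?_)
    have hd : √(d : ℝ) ^ 2 = d := Real.sq_sqrt (Nat.cast_nonneg d)
    have e1 : -((4 * δ * σ + δ ^ 2) * d) =
        -(2 * (δ * √d) * (2 * σ * √d) + (δ * √d) ^ 2) := by
      linear_combination (4 * δ * σ + δ ^ 2) * hd
    have e2 : ∑ i, (2 * (∑ j, A i j ω * (u - xo) j) * w i ω - (∑ j, A i j ω * (u - xo) j) ^ 2) =
        2 * inner ℝ (WithLp.toLp 2 (M.mulVec (u - xo).ofLp)) (WithLp.toLp 2 (fun i => w i ω)) -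
          ‖WithLp.toLp 2 (M.mulVec (u - xo).ofLp)‖ ^ 2 := by
      rw [EuclideanSpace.real_norm_sq_eq, PiLp.inner_apply, Finset.mul_sum,
        ← Finset.sum_sub_distrib]
      refine Finset.sum_congr rfl fun i _ => ?_
      simp only [hM, Matrix.mulVec, dotProduct, Matrix.of_apply, RCLike.inner_apply, conj_trivial]
      ring
    rw [hE₃, Set.mem_ofPred_eq, e1, e2]
    exact hcross
  have hwind : iIndepFun w μ := hind.precomp (g := Sum.inr) Sum.inr_injective
  have b₁ : μ.real E₁ ≤ Real.exp (-(d / 2)) := measureReal_exists_vertex_ge_le hA hind hρ0 hn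
  have b₂ : μ.real E₂ ≤ Real.exp (-(d / 2)) := measureReal_noise_ge_le hs0 hw hwind
  set c : ℝ := Real.exp ((4 * δ * σ + δ ^ 2) / (4 * σ ^ 2) * d) * (√(1 + 1 / r))⁻¹ ^ d
  have hc : 0 ≤ c := by positivity
  have b₃ : μ.real (⋃ u ∈ T, E₃ u) ≤ 2 ^ (k + 1) * c := by
    calc μ.real (⋃ u ∈ T, E₃ u) ≤ ∑ u ∈ T, μ.real (E₃ u) := measureReal_biUnion_finset_le _ _
      _ ≤ ∑ _u ∈ T, c := Finset.sum_le_sum fun u hu =>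
          measureReal_far_centre_le hs hr hσ hA hw hind (Finset.mem_filter.1 hu).2
      _ = T.card * c := by simp
      _ ≤ 2 ^ (k + 1) * c := by
          gcongr
          exact_mod_cast (Finset.card_filter_le _ _).trans hcard
  calc μ.real {ω | 9 * σ ^ 2 / r < ‖xo - xhat ω‖ ^ 2}
      ≤ μ.real (E₁ ∪ E₂ ∪ ⋃ u ∈ T, E₃ u) :=
        ENNReal.toReal_mono (measure_ne_top _ _) (measure_mono_ae
          (Filter.set_eventuallyLE_iff_mem_inf_principal.2 (Filter.mem_inf_principal.2 hsub)))
    _ ≤ μ.real E₁ + μ.real E₂ + μ.real (⋃ u ∈ T, E₃ u) :=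
        (measureReal_union_le _ _).trans (by gcongr; exact measureReal_union_le _ _)
    _ ≤ _ := by linarith

end ErrorBound

/-- The union bound over the `2 ^ (k + 1)` centres is affordable because `d ≥ 8 r k`:
`(1 + 1 / r) ^ (-d / 2)` is at most `exp (-8 k / 3)`, and `8 / 3 > log 2`. -/
theorem union_bound_lt {k d : ℕ} {r c : ℝ} (hr : 1 < r) (hk : 1 ≤ k) (hd : 8 * r * k ≤ d)
    (hd' : (d : ℝ) ≤ 9 * r * k) (hc : c * r ≤ 1 / 80) :
    2 ^ (k + 1) * (Real.exp (c * d) * (√(1 + 1 / r))⁻¹ ^ d) < Real.exp (-0.3 * k) := by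
  have hr0 : 0 < r := by linarith
  have hk' : (1 : ℝ) ≤ k := by exact_mod_cast hk
  have h2 : (2 : ℝ) ^ (k + 1) = Real.exp ((k + 1) * Real.log 2) := by
    rw [mul_comm, Real.exp_mul, Real.exp_log two_pos]
    exact_mod_cast rfl
  have hsq : (√(1 + 1 / r))⁻¹ ^ d = Real.exp (-(d / 2 * Real.log (1 + 1 / r))) := by
    have hpos : 0 < 1 + 1 / r := by positivity
    have h : (√(1 + 1 / r))⁻¹ = Real.exp (-(Real.log (1 + 1 / r) / 2)) := by
      rw [Real.exp_neg, ← Real.log_sqrt hpos.le, Real.exp_log (Real.sqrt_pos.2 hpos)]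
    rw [h, ← Real.exp_nat_mul]
    congr 1
    ring
  have hlog : 2 / 3 ≤ r * Real.log (1 + 1 / r) := by
    have h := Real.le_log_one_add_of_nonneg (x := 1 / r) (by positivity)
    calc 2 / 3 ≤ r * (2 * (1 / r) / (1 / r + 2)) := by
          field_simp
          linarith
      _ ≤ _ := by gcongr
  have hmain : 8 / 3 * (k : ℝ) ≤ d / 2 * Real.log (1 + 1 / r) := by
    have hl : 0 ≤ Real.log (1 + 1 / r) :=
      Real.log_nonneg (by have : 0 < 1 / r := by positivity
                          linarith)
    calc 8 / 3 * (k : ℝ) = 4 * k * (2 / 3) := by ring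
      _ ≤ 4 * k * (r * Real.log (1 + 1 / r)) := by gcongr
      _ = 8 * r * k / 2 * Real.log (1 + 1 / r) := by ring
      _ ≤ _ := by gcongr
  have hcd : c * d ≤ 9 / 80 * k := by
    rcases le_total c 0 with h | h
    · exact (mul_nonpos_of_nonpos_of_nonneg h (Nat.cast_nonneg d)).trans (by positivity)
    · calc c * d ≤ c * (9 * r * k) := by gcongr
        _ = 9 * k * (c * r) := by ring
        _ ≤ 9 * k * (1 / 80) := by gcongr
        _ = _ := by ring
  rw [h2, hsq, ← Real.exp_add, ← Real.exp_add, Real.exp_lt_exp]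
  have hlog2 := Real.log_two_lt_d9
  nlinarith

end KolmogorovCS

theorem theorem2
    (U : List Bool → List Bool →. List Bool) (hU : KolmogorovCS.IsOptimalMachine U)
    (r σ : ℝ) (hr : 1 < r) (hσ : 0 < σ) :
    ∃ N₀ D₀ : ℕ, ∀ (n : ℕ) (xo : EuclideanSpace ℝ (Fin n)) (m d : ℕ) (κ : ℝ),
      N₀ ≤ n → xo ∈ KolmogorovCS.cube n →
      m = ⌈Real.logb 2 n⌉₊ → κ = KolmogorovCS.kid U m xo → d = ⌈8 * r * κ * m⌉₊ → D₀ ≤ d →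
      -- the least-squares problem always has a solution
      (∀ (A : Matrix (Fin d) (Fin n) ℝ) (y : EuclideanSpace ℝ (Fin d)),
        ∃ x, KolmogorovCS.IsLLS U m (κ * m) A y x) ∧
      -- every choice of a solution is accurate with the stated probability
      ∀ (Ω : Type*) [MeasurableSpace Ω] (μ : Measure Ω) [IsProbabilityMeasure μ]
        (A : Fin d → Fin n → Ω → ℝ) (w : Fin d → Ω → ℝ),
        (∀ i j, HasLaw (A i j) (gaussianReal 0 1) μ) →
        (∀ i, HasLaw (w i) (gaussianReal 0 (⟨σ ^ 2, sq_nonneg σ⟩ : ℝ≥0)) μ) →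
        iIndepFun (Sum.elim (fun p : Fin d × Fin n => A p.1 p.2) w) μ →
        ∀ xhat : Ω → EuclideanSpace ℝ (Fin n),
          (∀ᵐ ω ∂μ, KolmogorovCS.IsLLS U m (κ * m) (Matrix.of fun i j => A i j ω)
            (WithLp.toLp 2 ((Matrix.of fun i j => A i j ω).mulVec xo.ofLp + fun i => w i ω))
            (xhat ω)) →
          μ.real {ω | 9 * σ ^ 2 / r < ‖xo - xhat ω‖ ^ 2} <
            6 * Real.exp (-0.01 * d) + Real.exp (-0.3 * m * κ) := by
  have hr0 : 0 < r := by linarith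
  -- The allowance `‖A q‖ ≤ δ √d` for quantisation; it must satisfy
  -- `(4 δ σ + δ²) / (4 σ²) ≤ 1 / (80 r)` to keep the loss in the union bound below `9 k / 80`.
  set δ : ℝ := σ / (100 * r) with hδ
  have hδ0 : 0 < δ := by positivity
  refine ⟨max 2 (max ⌈8 / δ ^ 2⌉₊ ⌈r / σ ^ 2⌉₊), max 1 ⌈8 / δ ^ 2⌉₊, ?_⟩
  intro n xo m d κ hn hxo hm hκ hd hD
  simp only [max_le_iff, Nat.ceil_le] at hn hD
  obtain ⟨hn2, hn8, hnr⟩ := hn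
  obtain ⟨hd1, hd8⟩ := hD
  have hn0 : (0 : ℝ) < n := by exact_mod_cast (by omega : 0 < n)
  have hd0 : (0 : ℝ) < d := by exact_mod_cast hd1
  have hm0 : m ≠ 0 := by
    rw [hm]
    exact (Nat.ceil_pos.2 (Real.logb_pos one_lt_two (by exact_mod_cast hn2))).ne'
  have hm0' : (m : ℝ) ≠ 0 := Nat.cast_ne_zero.2 hm0
  set k := (KolmogorovCS.quantK U m xo).toNat with hk
  have hκm : κ * m = k := by
    rw [hκ, KolmogorovCS.kid, div_mul_cancel₀ _ hm0']
  have hdk : d = ⌈8 * r * k⌉₊ := by rw [hd, mul_assoc, hκm]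
  -- Measurements are only taken when the complexity is positive.
  have hk1 : 1 ≤ k := by
    by_contra h
    have h0 : k = 0 := by omega
    rw [h0] at hdk
    simp at hdk
    omega
  have hfin : KolmogorovCS.quantK U m xo = k :=
    (ENat.natCast_toNat (KolmogorovCS.quantK_ne_top hU m hxo)).symm
  have hfeas : xo ∈ KolmogorovCS.feasible U n m k := ⟨hxo, k, hfin, le_rfl⟩
  rw [hκm]
  refine ⟨KolmogorovCS.exists_isLLS ⟨xo, hfeas⟩, ?_⟩
  intro Ω _ μ _ A w hA hw hind xhat hxhat
  have hres : n * ((1 / 2 : ℝ) ^ m) ^ 2 ≤ 1 / n := by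
    have h : (n : ℝ) ≤ 2 ^ m := by
      have h1 : Real.logb 2 n ≤ m := hm ▸ Nat.le_ceil _
      rw [Real.logb_le_iff_le_rpow one_lt_two hn0] at h1
      exact_mod_cast h1
    have h' : (1 / 2 : ℝ) ^ m ≤ 1 / n := by
      rw [one_div, inv_pow, ← one_div]
      exact one_div_le_one_div_of_le hn0 h
    calc n * ((1 / 2 : ℝ) ^ m) ^ 2 ≤ n * (1 / n : ℝ) ^ 2 := by gcongr
      _ = 1 / (n : ℝ) := by field_simp
  have hcube : 4 * (n * ((1 / 2 : ℝ) ^ m) ^ 2) * (n + d) ≤ δ ^ 2 * d := by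
    rw [div_le_iff₀ (by positivity)] at hn8 hd8
    calc 4 * (n * ((1 / 2 : ℝ) ^ m) ^ 2) * (n + d) ≤ 4 * (1 / n) * (n + d) := by gcongr
      _ = 4 + 4 * d / n := by field_simp
      _ ≤ δ ^ 2 * d / 2 + δ ^ 2 * d / 2 := by
          gcongr ?_ + ?_
          · linarith
          · rw [div_le_iff₀ hn0]
            nlinarith
      _ = δ ^ 2 * d := by ring
  have hres' : n * ((1 / 2 : ℝ) ^ m) ^ 2 ≤ σ ^ 2 / r := by
    refine hres.trans ?_
    rw [div_le_iff₀ (by positivity)] at hnr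
    rw [div_le_div_iff₀ hn0 hr0]
    linarith
  have hk1' : (1 : ℝ) ≤ k := by exact_mod_cast hk1
  have hlow : 8 * r * k ≤ d := hdk ▸ Nat.le_ceil _
  have hupp : (d : ℝ) ≤ 9 * r * k := by
    have h : (d : ℝ) < 8 * r * k + 1 := by rw [hdk]; exact Nat.ceil_lt_add_one (by positivity)
    nlinarith
  have hc : (4 * δ * σ + δ ^ 2) / (4 * σ ^ 2) * r ≤ 1 / 80 := by
    have h : (4 * δ * σ + δ ^ 2) / (4 * σ ^ 2) * r = 1 / 100 + 1 / (40000 * r) := by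
      rw [hδ]
      field_simp
      ring
    have h' : 1 / (40000 * r) ≤ 1 / 40000 := one_div_le_one_div_of_le (by norm_num) (by linarith)
    rw [h]
    linarith
  refine (KolmogorovCS.measureReal_error_le rfl hr0 hσ hδ0 (by omega) hcube hres' hfeas hA hw hind
    hxhat).trans_lt (add_lt_add_of_le_of_lt ?_ ?_)
  · have h : Real.exp (-(d / 2)) ≤ Real.exp (-0.01 * d) := Real.exp_le_exp.2 (by linarith)
    linarith [Real.exp_pos (-0.01 * d)]
  · have h : -0.3 * (m : ℝ) * κ = -0.3 * k := by rw [mul_assoc, mul_comm (m : ℝ), hκm]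
    rw [h]
    exact KolmogorovCS.union_bound_lt hr hk1 hlow hupp hc
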